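/- **Setting.** Let $G=(V,E)$ be a finite simple undirected graph on $n$ vertices, with degrees $d_v$. - $G$ is *$(D,c)$-uniform* if $D\le d_v\le cD$ for all $v\in V$. - The standard random walk moves from $u$ to a uniformly random neighbour of $u$. Its stationary distribution is $\mu(v)=d_v/(2|E|)$. The *$\delta$-mixing time* is the least $s$ such that, for every starting vertex, the distribution $\mu'$ of the walk after $s$ steps satisfies $\|\mu'-\mu\|_\infty\le\delta$. Let $T(n)$ denote the $\delta$-mixing time of $G$ for $\delta=\frac{1}{(2cn)^2}$ (assumed to exist). - A *"good start" random walk of length $t$* starts at vertex $v$ with probability $d_v/(2|E|)$ and then makes $t$ steps of the standard random walk. - A *regularized walk* adapted from a walk $W$ is a walk in $G$ (of any length, with any end points) that visits exactly the edges visited by $W$, and each of them at most twice. (Every walk has one.) - Given $m$ independent "good start" random walks of length $t$ and, for each, a regularized walk adapted from it, the *measurement matrix* $A\in\mathbb{R}^{m\times|E|}$ has as entry $A_{i,e}$ the number of times the $i$-th regularized walk traverses the edge $e$. - *$\ell_1$ minimization recovers* $x\in\mathbb{R}^{E}$ if $x$ is the unique minimizer of $\|z\|_1$ over all $z\in\mathbb{R}^E$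 with $Az=Ax$. **Theorem ($\ell_1$ minimization succeeds).** For every $B>0$ there are constants $\tau,C,C_0>0$ such that for all $c\ge 1$, all $T_0\in\mathbb{N}$ and all $\varepsilon>0$ there is an $N$ such that the following holds for all $n\ge N$. Let $G$ be a $(D,c)$-uniform graph on $n$ vertices with $T(n)\le T_0$, let $k\ge 1$ be an integer, suppose that $D\ge C_0c^2kT(n)^2$, and put $$m=\lceil C\,T(n)\,k\log n\rceil,\qquad t=\lfloor \tau |E|/k\rfloor .$$ Then, with probability at least $1-\varepsilon$ over $m$ independent "good start" random walks of length $t$ on $G$, the following holds: for every choice of regularized walks adapted from them, $\ell_1$ minimization with the resulting measurement matrix $A$ recovers every vector $x\in\mathbb{R}^{E}$ with at most $Bk$ nonzero entries. In other words, with probability $1-o(1)$ as $n\to\infty$, $\ell_1$ minimization recovers every $\Theta(k)$-sparse edge vector from $m=O(T(n)k\log n)$ independent "good start" regularized random walks of length $t=O(|E|/k)$. -/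

import Mathlib

namespace GraphCS

variable {V : Type*} [Fintype V] [DecidableEq V]

/-- `(D, c)`-uniform graph: every degree lies between `D` and `c * D`. -/
def IsUniform (G : SimpleGraph V) [DecidableRel G.Adj] (D : ℕ) (c : ℝ) : Prop :=
  ∀ v, D ≤ G.degree v ∧ (G.degree v : ℝ) ≤ c * D

/-- Number of edges `|E|`. -/
def numEdges (G : SimpleGraph V) [DecidableRel G.Adj] : ℕ := G.edgeFinset.card

/-- Transition matrix of the standard random walk: move to a uniformly random neighbour. -/
noncomputable def stepMatrix (G : SimpleGraph V) [DecidableRel G.Adj] : Matrix V V ℝ :=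
  Matrix.of fun u v => if G.Adj u v then (1 : ℝ) / G.degree u else 0

/-- The stationary distribution `d_v / (2|E|)` of the standard random walk. -/
noncomputable def stationary (G : SimpleGraph V) [DecidableRel G.Adj] (v : V) : ℝ :=
  (G.degree v : ℝ) / (2 * numEdges G)

/-- `T` is the `δ`-mixing time: the least `s` such that, from every starting vertex `u`, the
distribution after `s` steps is within `δ` of the stationary one in the sup norm.
(No such `T` exists when the walk never gets `δ`-close, e.g. on bipartite graphs with
small `δ`.) -/
def IsMixingTime (G : SimpleGraph V) [DecidableRel G.Adj] (δ : ℝ) (T : ℕ) : Prop :=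
  IsLeast {s : ℕ | ∀ u v, |(stepMatrix G ^ s) u v - stationary G v| ≤ δ} T

/-- Probability that the "good start" random walk with `t` steps follows the vertex sequence
`w 0, w 1, …, w t`. -/
noncomputable def goodStartProb (G : SimpleGraph V) [DecidableRel G.Adj] {t : ℕ}
    (w : Fin (t + 1) → V) : ℝ :=
  stationary G (w 0) * ∏ i : Fin t, stepMatrix G (w i.castSucc) (w i.succ)

/-- The random vertex sequence `W` is a "good start" random walk with `t` steps on `G`. -/
def IsGoodStartWalk (G : SimpleGraph V) [DecidableRel G.Adj] {t : ℕ} {Ω : Type*}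
    [MeasurableSpace Ω] (P : MeasureTheory.Measure Ω) (W : Ω → Fin (t + 1) → V) : Prop :=
  ∀ w : Fin (t + 1) → V,
    MeasurableSet {ω | W ω = w} ∧ P.real {ω | W ω = w} = goodStartProb G w

/-- The edges traversed by a vertex sequence. -/
def visitedEdges {t : ℕ} (w : Fin (t + 1) → V) : Set (Sym2 V) :=
  {e | ∃ i : Fin t, e = s(w i.castSucc, w i.succ)}

/-- A regularized walk adapted from the vertex sequence `w`: a walk in `G` (of any length and
with any end points) that visits exactly the edges visited by `w`, each at most twice. -/
structure RegularizedWalk (G : SimpleGraph V) {t : ℕ} (w : Fin (t + 1) → V) where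
  start : V
  finish : V
  walk : G.Walk start finish
  mem_edges_iff : ∀ e, e ∈ walk.edges ↔ e ∈ visitedEdges w
  count_le_two : ∀ e, walk.edges.count e ≤ 2

/-- Every walk has a regularized walk adapted from it. -/
theorem RegularizedWalk.nonempty (G : SimpleGraph V) {t : ℕ} (w : Fin (t + 1) → V)
    (hw : ∀ i : Fin t, G.Adj (w i.castSucc) (w i.succ)) : Nonempty (RegularizedWalk G w) := by
  suffices H : ∃ (u v : V) (p : G.Walk u v), (∀ e, e ∈ p.edges ↔ e ∈ visitedEdges w) ∧
      (∀ e, p.edges.count e ≤ 2) ∧ w (Fin.last t) ∈ p.support by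
    obtain ⟨u, v, p, h1, h2, -⟩ := H
    exact ⟨⟨u, v, p, h1, h2⟩⟩
  induction t with
  | zero => exact ⟨_, _, SimpleGraph.Walk.nil' (w 0), by simp [visitedEdges], by simp, by simp⟩
  | succ t ih =>
    obtain ⟨u, v, p, h1, h2, h3⟩ := ih (fun i => w i.castSucc) (fun i => hw i.castSucc)
    have hadj := hw (Fin.last t)
    rw [Fin.succ_last] at hadj
    have hvis : ∀ e, e ∈ visitedEdges w ↔
        e ∈ visitedEdges (fun i : Fin (t + 1) => w i.castSucc) ∨
          e = s(w (Fin.last t).castSucc, w (Fin.last (t + 1))) := by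
      intro e
      simp only [visitedEdges, Set.mem_ofPred_eq]
      constructor
      · rintro ⟨i, rfl⟩
        induction i using Fin.lastCases with
        | last => right; rw [Fin.succ_last]
        | cast i => left; exact ⟨i, rfl⟩
      · rintro (⟨i, rfl⟩ | rfl)
        · exact ⟨i.castSucc, rfl⟩
        · exact ⟨Fin.last t, by rw [Fin.succ_last]⟩
    by_cases he : s(w (Fin.last t).castSucc, w (Fin.last (t + 1))) ∈ p.edges
    · refine ⟨u, v, p, fun e => ?_, h2, p.snd_mem_support_of_mem_edges he⟩
      rw [hvis, ← h1]
      constructor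
      · exact Or.inl
      · rintro (h | rfl)
        · exact h
        · exact he
    · have hsp := p.take_spec h3
      have hed : p.edges = (p.takeUntil _ h3).edges ++ (p.dropUntil _ h3).edges := by
        rw [← SimpleGraph.Walk.edges_append, hsp]
      refine ⟨u, v, (p.takeUntil _ h3).append
        (.cons hadj (.cons hadj.symm (p.dropUntil _ h3))), fun e => ?_, fun e => ?_, ?_⟩
      · rw [hvis, ← h1, hed]
        simp only [SimpleGraph.Walk.edges_append, SimpleGraph.Walk.edges_cons, List.mem_append,
          List.mem_cons, Sym2.eq_swap (a := w (Fin.last (t + 1)))]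
        tauto
      · have h2e := h2 e
        rw [hed, List.count_append] at h2e
        simp only [SimpleGraph.Walk.edges_append, SimpleGraph.Walk.edges_cons, List.count_append,
          List.count_cons, Sym2.eq_swap (a := w (Fin.last (t + 1)))]
        by_cases hee : s(w (Fin.last t).castSucc, w (Fin.last (t + 1))) = e
        · have h0 : p.edges.count e = 0 := List.count_eq_zero.2 (hee ▸ he)
          rw [hed, List.count_append] at h0
          simp only [hee, beq_self_eq_true, if_true]
          omega
        · simp only [beq_iff_eq, hee, if_false]
          omega
      · simp [SimpleGraph.Walk.mem_support_append_iff]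

/-- The `m × |E|` measurement matrix: the entry `(i, e)` is the number of times the `i`-th
regularized walk traverses the edge `e`. -/
def measurementMatrix {G : SimpleGraph V} {m t : ℕ} {W : Fin m → Fin (t + 1) → V}
    (R : ∀ i, RegularizedWalk G (W i)) : Matrix (Fin m) G.edgeSet ℝ :=
  Matrix.of fun i e => ((R i).walk.edges.count (e : Sym2 V) : ℝ)

/-- `ℓ₁` minimization recovers `x` from `y = A x`: `x` is the unique minimizer of `‖z‖₁`
subject to `A z = y`. -/
def L1Recovers {ι κ : Type*} [Fintype κ] (A : Matrix ι κ ℝ) (x : κ → ℝ) : Prop :=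
  ∀ z : κ → ℝ, A.mulVec z = A.mulVec x → z ≠ x → ∑ j, |x j| < ∑ j, |z j|

/-- `x` has at most `s` nonzero entries. -/
def IsSparse {κ : Type*} (x : κ → ℝ) (s : ℝ) : Prop :=
  ((Function.support x).ncard : ℝ) ≤ s

end GraphCS

set_option linter.unusedSectionVars false

/-! ### Deterministic part: few collisions imply the null space property -/

namespace GraphCS

open Finset

/-! Regard the walks and the edges they visit as a bipartite graph. Recovery follows from two
properties: every edge is visited by at least `d` walks, and for every set `S` of at most `2 * s`
edges the collisions, i.e. visits by a walk to `S` beyond its first, number at most `d / 16 * #S`.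
This is an unbalanced-expander condition, and it survives regularization, since only the set of
visited edges matters and all nonzero entries of the matrix lie in `[1, 2]`.

Deterministic half (`sum_abs_lt_of_mulVec_eq_zero`): for a kernel vector, let `S` carry its `s`
largest entries. Few collisions inside `S` mean that most rows see essentially one entry of `S`,
which the tail must cancel; few collisions in `S ∪ L` mean that rows meeting `S` see too little of
the tail to do so unless the tail dominates. This is the null space property.

Probabilistic half: a short walk in a dense, rapidly mixing graph makes a small expected number of
steps in `S`, at most `ρ`, from every starting vertex (`expCount_le`): before mixing because degrees
are large, afterwards because `S` is a small fraction of the edges. So after one hit another is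
unlikely, which bounds the exponential moment of the collisions and makes the probability of a visit
comparable to the expected number of hits. Chernoff bounds over the independent walks give failure
probability `n⁻⁴` per edge and `n^(-4 * #S)` per set, small enough for a union bound over all edges
and all nonempty sets. -/

theorem exists_rep_sum_sub_le {ι κ : Type*} [Fintype ι] [DecidableEq κ] (E : ι → Finset κ)
    (β : ℝ) (S : Finset κ) : ∀ (w : κ → ℝ), (∀ e ∈ S, 0 ≤ w e) →
    (∀ S' ⊆ S, ∑ i, ((#(E i ∩ S') - 1 : ℕ) : ℝ) ≤ β * #S') →
    ∃ f : ι → ℝ, (∀ i, (E i ∩ S = ∅ ∧ f i = 0) ∨ ∃ e ∈ E i ∩ S, f i = w e) ∧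
      ∑ i, (∑ e ∈ E i ∩ S, w e - f i) ≤ β * ∑ e ∈ S, w e := by
  induction S using Finset.strongInduction with
  | H S ih =>
  intro w hw h
  rcases S.eq_empty_or_nonempty with rfl | hS
  · exact ⟨0, by simp, by simp⟩
  -- Layer-cake induction: peel the minimal weight off all of `S`, which makes the weight of `a`
  -- vanish. Putting the layer back raises the excess of row `i` by `w a` times its collisions in
  -- `S`, and the hypothesis for `S` itself pays for the total.
  obtain ⟨a, ha, hmin⟩ := S.exists_min_image w hS
  obtain ⟨f, hf, hsum⟩ := ih (S.erase a) (erase_ssubset ha) (fun e => w e - w a)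
    (fun e he => sub_nonneg.2 (hmin e (mem_of_mem_erase he)))
    (fun S' hS' => h S' (hS'.trans (erase_subset _ _)))
  have hrow : ∀ i, ∃ y : ℝ, ((E i ∩ S = ∅ ∧ y = 0) ∨ ∃ e ∈ E i ∩ S, y = w e) ∧
      ∑ e ∈ E i ∩ S, w e - y
        = (∑ e ∈ E i ∩ S.erase a, (w e - w a) - f i) + w a * ((#(E i ∩ S) - 1 : ℕ) : ℝ) := by
    intro i
    have hs : ∑ e ∈ E i ∩ S, w e
        = ∑ e ∈ E i ∩ S.erase a, (w e - w a) + w a * #(E i ∩ S) := by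
      have h1 : ∑ e ∈ E i ∩ S.erase a, (w e - w a) = ∑ e ∈ E i ∩ S, (w e - w a) := by
        apply sum_subset (inter_subset_inter_left (erase_subset _ _))
        intro e he hne
        have : e = a := by
          by_contra hea
          exact hne (mem_inter.2 ⟨(mem_inter.1 he).1, mem_erase.2 ⟨hea, (mem_inter.1 he).2⟩⟩)
        simp [this]
      rw [h1, sum_sub_distrib, sum_const, nsmul_eq_mul]
      ring
    rcases (E i ∩ S).eq_empty_or_nonempty with hE | hE
    · refine ⟨0, Or.inl ⟨hE, rfl⟩, ?_⟩
      have h2 : E i ∩ S.erase a = ∅ :=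
        subset_empty.1 (hE ▸ inter_subset_inter_left (erase_subset _ _))
      rcases hf i with ⟨-, h0⟩ | ⟨e, he, -⟩
      · simp [hE, h2, h0]
      · simp [h2] at he
    · have hc : ((#(E i ∩ S) - 1 : ℕ) : ℝ) = #(E i ∩ S) - 1 := by
        rw [Nat.cast_sub hE.card_pos]; simp
      refine ⟨f i + w a, Or.inr ?_, by rw [hs, hc]; ring⟩
      rcases hf i with ⟨h2, h0⟩ | ⟨e, he, h0⟩
      · obtain ⟨e, he⟩ := hE
        have : e = a := by
          by_contra hea
          have : e ∈ E i ∩ S.erase a :=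
            mem_inter.2 ⟨(mem_inter.1 he).1, mem_erase.2 ⟨hea, (mem_inter.1 he).2⟩⟩
          simp [h2] at this
        exact ⟨e, he, by rw [h0, this, zero_add]⟩
      · exact ⟨e, inter_subset_inter_left (erase_subset _ _) he, by rw [h0]; ring⟩
  choose g hg hgs using hrow
  refine ⟨g, hg, ?_⟩
  simp_rw [hgs]
  rw [sum_add_distrib, ← mul_sum]
  have h3 : ∑ e ∈ S, w e = ∑ e ∈ S.erase a, (w e - w a) + w a * #S := by
    rw [sum_erase _ (by simp), sum_sub_distrib, sum_const, nsmul_eq_mul]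
    ring
  have h4 := mul_le_mul_of_nonneg_left (h S subset_rfl) (hw a ha)
  rw [h3]
  linarith

/-- If every sum of `b` over at most `s` indices is at most `β`, then only few `b e` exceed the
average `β / s`, and a weighted sum of `b` is controlled by the sum and the maximum of the
weights. -/
theorem sum_mul_le_of_sum_le {κ : Type*} [DecidableEq κ] (R : Finset κ) (b w : κ → ℝ) (β M : ℝ)
    (s : ℕ) (hs : 1 ≤ s) (hb : ∀ e ∈ R, 0 ≤ b e) (hw : ∀ e ∈ R, 0 ≤ w e)
    (hM : ∀ e ∈ R, w e ≤ M) (hM0 : 0 ≤ M) (h : ∀ L ⊆ R, #L ≤ s → ∑ e ∈ L, b e ≤ β) :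
    ∑ e ∈ R, b e * w e ≤ β / s * ∑ e ∈ R, w e + β * M := by
  have hs0 : (0 : ℝ) < s := by exact_mod_cast hs
  set L := {e ∈ R | β / s < b e} with hL
  have hLR : L ⊆ R := filter_subset _ _
  have hβ : 0 ≤ β := by simpa using h ∅ (by simp) (by simp)
  have hcard : #L ≤ s := by
    by_contra hc
    obtain ⟨L', hL', hc'⟩ := exists_subset_card_eq (not_le.1 hc).le
    have h1 := h L' (hL'.trans hLR) hc'.le
    have hne : L'.Nonempty := card_pos.1 (by omega)
    have h2 : ∑ e ∈ L', β / s < ∑ e ∈ L', b e :=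
      sum_lt_sum_of_nonempty hne fun e he => (mem_filter.1 (hL' he)).2
    rw [sum_const, hc', nsmul_eq_mul, mul_div_cancel₀ _ hs0.ne'] at h2
    linarith
  rw [← sum_sdiff hLR]
  have h1 : ∑ e ∈ L, b e * w e ≤ β * M := by
    calc ∑ e ∈ L, b e * w e ≤ ∑ e ∈ L, b e * M :=
          sum_le_sum fun e he => mul_le_mul_of_nonneg_left (hM e (hLR he)) (hb e (hLR he))
      _ = (∑ e ∈ L, b e) * M := by rw [sum_mul]
      _ ≤ β * M := mul_le_mul_of_nonneg_right (h L hLR hcard) hM0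
  have h2 : ∑ e ∈ R \ L, b e * w e ≤ β / s * ∑ e ∈ R, w e := by
    calc ∑ e ∈ R \ L, b e * w e ≤ ∑ e ∈ R \ L, β / s * w e := by
          refine sum_le_sum fun e he => mul_le_mul_of_nonneg_right ?_ (hw e (mem_sdiff.1 he).1)
          by_contra hc
          exact (mem_sdiff.1 he).2 (mem_filter.2 ⟨(mem_sdiff.1 he).1, not_le.1 hc⟩)
      _ ≤ β / s * ∑ e ∈ R, w e := by
          rw [← mul_sum]
          exact mul_le_mul_of_nonneg_left (sum_le_sum_of_subset_of_nonneg sdiff_subset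
            fun e he _ => hw e he) (by positivity)
  linarith

/-- Exchange argument for a set of maximal weight: an outside element could be added if there is
room, and otherwise swapped for any element of `S`. -/
theorem exists_top_set {κ : Type*} [Fintype κ] [DecidableEq κ] (w : κ → ℝ) (hw : ∀ e, 0 ≤ w e)
    (s : ℕ) : ∃ S : Finset κ, #S ≤ s ∧ (∀ S' : Finset κ, #S' ≤ s → ∑ e ∈ S', w e ≤ ∑ e ∈ S, w e) ∧
      ∀ e ∉ S, s * w e ≤ ∑ e ∈ S, w e := by
  obtain ⟨S, hS, hmax⟩ := exists_max_image (univ.filter fun S : Finset κ => #S ≤ s)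
    (fun S => ∑ e ∈ S, w e) ⟨∅, by simp⟩
  simp only [mem_filter, mem_univ, true_and] at hS hmax
  refine ⟨S, hS, hmax, fun e he => ?_⟩
  rcases hS.lt_or_eq with hlt | heq
  · have := hmax (insert e S) (by rw [card_insert_of_notMem he]; omega)
    rw [sum_insert he] at this
    have h0 : w e = 0 := le_antisymm (by linarith) (hw e)
    rw [h0, mul_zero]
    exact sum_nonneg fun e _ => hw e
  · rw [← heq, ← nsmul_eq_mul]
    refine card_nsmul_le_sum _ _ _ fun a ha => ?_
    have hea : e ∉ S.erase a := fun h => he (mem_of_mem_erase h)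
    have := hmax (insert e (S.erase a)) (by
      rw [card_insert_of_notMem hea, card_erase_add_one ha]; exact hS)
    rw [sum_insert hea, ← add_sum_erase S w ha] at this
    linarith

/-- The representative contributes at least `y` and the other entries cancel at most twice their
mass; `y - 2 * rest` is `total - 3 * rest`. -/
theorem le_abs_row_sum {κ : Type*} [DecidableEq κ] (F : Finset κ) (a z : κ → ℝ) (y : ℝ)
    (ha : ∀ e ∈ F, 1 ≤ a e ∧ a e ≤ 2) (hy : (F = ∅ ∧ y = 0) ∨ ∃ e ∈ F, y = |z e|) :
    ∑ e ∈ F, |z e| - 3 * (∑ e ∈ F, |z e| - y) ≤ |∑ e ∈ F, a e * z e| := by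
  rcases hy with ⟨rfl, rfl⟩ | ⟨e, he, rfl⟩
  · simp
  rw [← add_sum_erase F (fun e => a e * z e) he, ← add_sum_erase F (fun e => |z e|) he]
  have h1 : |z e| ≤ |a e * z e| := by
    rw [abs_mul]
    exact le_mul_of_one_le_left (abs_nonneg _) ((ha e he).1.trans (le_abs_self _))
  have h2 : |∑ x ∈ F.erase e, a x * z x| ≤ 2 * ∑ x ∈ F.erase e, |z x| := by
    rw [mul_sum]
    refine (abs_sum_le_sum_abs _ _).trans (sum_le_sum fun x hx => ?_)
    have := ha x (mem_of_mem_erase hx)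
    rw [abs_mul, abs_of_nonneg (by linarith)]
    exact mul_le_mul_of_nonneg_right this.2 (abs_nonneg _)
  have h3 : |a e * z e| ≤ |a e * z e + ∑ x ∈ F.erase e, a x * z x|
      + |∑ x ∈ F.erase e, a x * z x| := by
    have := abs_sub (a e * z e + ∑ x ∈ F.erase e, a x * z x) (∑ x ∈ F.erase e, a x * z x)
    simpa using this
  linarith

/-- Null space property. It suffices to treat the top set `S`, whose mass `X` is compared with the
tail mass `Y` by summing the kernel equations of the rows that meet `S`. -/
theorem sum_abs_lt_of_mulVec_eq_zero {ι κ : Type*} [Fintype ι] [Fintype κ] [DecidableEq κ]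
    (A : Matrix ι κ ℝ) (E : ι → Finset κ)
    (hA0 : ∀ i e, e ∉ E i → A i e = 0) (hA1 : ∀ i, ∀ e ∈ E i, 1 ≤ A i e ∧ A i e ≤ 2)
    (d : ℝ) (hd : 0 < d) (s : ℕ) (hs : 1 ≤ s)
    (hdeg : ∀ e, d ≤ #{i | e ∈ E i})
    (hcoll : ∀ S : Finset κ, #S ≤ 2 * s → ∑ i, ((#(E i ∩ S) - 1 : ℕ) : ℝ) ≤ d / 16 * #S)
    (z : κ → ℝ) (hz : A.mulVec z = 0) (hne : z ≠ 0) (S₀ : Finset κ) (hS₀ : #S₀ ≤ s) :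
    2 * ∑ e ∈ S₀, |z e| < ∑ e, |z e| := by
  have hs0 : (0 : ℝ) < s := by exact_mod_cast hs
  obtain ⟨S, hS, hmax, htail⟩ := exists_top_set (fun e => |z e|) (fun e => abs_nonneg _) s
  obtain ⟨f, hf, hfs⟩ := exists_rep_sum_sub_le E (d / 16) S (fun e => |z e|)
    (fun e _ => abs_nonneg _)
    (fun S' hS' => hcoll S' ((card_le_card hS').trans (by omega)))
  set X := ∑ e ∈ S, |z e| with hX
  set Y := ∑ e ∈ Sᶜ, |z e| with hY
  have hXY : X + Y = ∑ e, |z e| := sum_add_sum_compl _ _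
  have hpos : 0 < ∑ e, |z e| := by
    obtain ⟨e, he⟩ := Function.ne_iff.1 hne
    exact sum_pos' (fun e _ => abs_nonneg _) ⟨e, mem_univ _, abs_pos.2 he⟩
  have hX0 : 0 ≤ X := sum_nonneg fun _ _ => abs_nonneg _
  -- Only rows meeting `S` are used. In such a row the first visit is already spent on `S`, so each
  -- element of `L` it contains is a collision in `S ∪ L`.
  set b : κ → ℝ := fun e => #{i | e ∈ E i ∧ (E i ∩ S).Nonempty} with hb
  have hbL : ∀ L ⊆ Sᶜ, #L ≤ s → ∑ e ∈ L, b e ≤ d / 16 * (2 * s) := by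
    intro L hL hLs
    have hdis : Disjoint S L := by
      rw [disjoint_left]; intro e he heL; exact mem_compl.1 (hL heL) he
    have hcard : #(S ∪ L) = #S + #L := card_union_of_disjoint hdis
    have h1 := hcoll (S ∪ L) (by omega)
    have h2 : ∑ e ∈ L, b e ≤ ∑ i, ((#(E i ∩ (S ∪ L)) - 1 : ℕ) : ℝ) := by
      simp only [hb, card_filter]
      push_cast
      rw [sum_comm]
      refine sum_le_sum fun i _ => ?_
      by_cases hi : (E i ∩ S).Nonempty
      · have h3 : ∑ e ∈ L, (if e ∈ E i ∧ (E i ∩ S).Nonempty then (1 : ℝ) else 0)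
            = ((#(E i ∩ L) : ℕ) : ℝ) := by
          simp only [hi, and_true]
          rw [sum_boole, filter_mem_eq_inter, inter_comm]
        rw [h3]
        have h4 : #(E i ∩ (S ∪ L)) = #(E i ∩ S) + #(E i ∩ L) := by
          rw [inter_union_distrib_left, card_union_of_disjoint]
          exact hdis.mono inter_subset_right inter_subset_right
        have := hi.card_pos
        exact_mod_cast (by omega : #(E i ∩ L) ≤ #(E i ∩ (S ∪ L)) - 1)
      · simp [hi]
    have h3 : ((#(S ∪ L) : ℕ) : ℝ) ≤ 2 * s := by exact_mod_cast (by omega : #(S ∪ L) ≤ 2 * s)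
    exact h2.trans (h1.trans (mul_le_mul_of_nonneg_left h3 (by positivity)))
  have htail' := sum_mul_le_of_sum_le Sᶜ b (fun e => |z e|) _ (X / s) s hs
    (fun e _ => Nat.cast_nonneg _) (fun e _ => abs_nonneg _)
    (fun e he => by
      rw [le_div_iff₀ hs0, mul_comm]; exact htail e (mem_compl.1 he)) (by positivity) hbL
  rw [show d / 16 * (2 * s) / s * ∑ e ∈ Sᶜ, |z e| + d / 16 * (2 * s) * (X / s)
    = d / 8 * (Y + X) by rw [← hY]; field_simp; ring] at htail'
  -- In a kernel equation the part on `S` is minus the part on the tail, and the entries are at most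
  -- 2.
  have hrow : ∀ i, ∑ e ∈ E i ∩ S, |z e| - 3 * (∑ e ∈ E i ∩ S, |z e| - f i)
      ≤ 2 * ∑ e ∈ Sᶜ, if e ∈ E i ∧ (E i ∩ S).Nonempty then |z e| else 0 := by
    intro i
    by_cases hi : (E i ∩ S).Nonempty
    · refine (le_abs_row_sum (E i ∩ S) (A i) z (f i)
        (fun e he => hA1 i e (mem_inter.1 he).1) (hf i)).trans ?_
      have h0 : ∑ e, A i e * z e = 0 := congrFun hz i
      rw [← sum_add_sum_compl S] at h0
      have h1 : ∑ e ∈ S, A i e * z e = ∑ e ∈ E i ∩ S, A i e * z e := by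
        symm
        apply sum_subset inter_subset_right
        intro e he hn
        rw [hA0 i e (fun h => hn (mem_inter.2 ⟨h, he⟩)), zero_mul]
      rw [← h1, eq_neg_of_add_eq_zero_left h0, abs_neg, mul_sum]
      refine (abs_sum_le_sum_abs _ _).trans (sum_le_sum fun e _ => ?_)
      by_cases he : e ∈ E i
      · simp only [he, hi, and_self, if_true]
        have := hA1 i e he
        rw [abs_mul, abs_of_nonneg (by linarith)]
        exact mul_le_mul_of_nonneg_right this.2 (abs_nonneg _)
      · simp [hA0 i e he, he]
    · have hi' := not_nonempty_iff_eq_empty.1 hi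
      rcases hf i with ⟨-, h0⟩ | ⟨e, he, -⟩
      · simp [hi', h0]
      · simp [hi'] at he
  have hsum := sum_le_sum fun i (_ : i ∈ (univ : Finset ι)) => hrow i
  rw [sum_sub_distrib, ← mul_sum, ← mul_sum, sum_comm] at hsum
  have hR : ∑ e ∈ Sᶜ, ∑ i, (if e ∈ E i ∧ (E i ∩ S).Nonempty then |z e| else 0)
      = ∑ e ∈ Sᶜ, b e * |z e| := by
    refine sum_congr rfl fun e _ => ?_
    rw [← sum_filter, sum_const, nsmul_eq_mul]
  have hLft : d * X ≤ ∑ i, ∑ e ∈ E i ∩ S, |z e| := by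
    have : ∑ i, ∑ e ∈ E i ∩ S, |z e| = ∑ e ∈ S, (#{i | e ∈ E i} : ℝ) * |z e| := by
      simp_rw [inter_comm _ S, ← filter_mem_eq_inter, sum_filter]
      rw [sum_comm]
      refine sum_congr rfl fun e _ => ?_
      rw [← sum_filter, sum_const, nsmul_eq_mul]
    rw [this, hX, mul_sum]
    exact sum_le_sum fun e _ => mul_le_mul_of_nonneg_right (hdeg e) (abs_nonneg _)
  rw [hR] at hsum
  -- Summed over rows: `d * X - (3 * d / 16) * X ≤ 2 * (d / 8) * (X + Y)`.
  have hfin : d * (9 * X) ≤ d * (4 * Y) := by linarith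
  have hfin' := le_of_mul_le_mul_left hfin hd
  have := hmax S₀ hS₀
  linarith

/-- The difference `z - x` is in the kernel, so less than half of its mass lies on the support of
`x`; what `z` can save there is less than what it pays off the support. -/
theorem l1Recovers_of_expansion {ι κ : Type*} [Fintype ι] [Fintype κ] [DecidableEq κ]
    (A : Matrix ι κ ℝ) (E : ι → Finset κ)
    (hA0 : ∀ i e, e ∉ E i → A i e = 0) (hA1 : ∀ i, ∀ e ∈ E i, 1 ≤ A i e ∧ A i e ≤ 2)
    (d : ℝ) (hd : 0 < d) (s : ℕ) (hs : 1 ≤ s)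
    (hdeg : ∀ e, d ≤ #{i | e ∈ E i})
    (hcoll : ∀ S : Finset κ, #S ≤ 2 * s → ∑ i, ((#(E i ∩ S) - 1 : ℕ) : ℝ) ≤ d / 16 * #S)
    (x : κ → ℝ) (hx : (Function.support x).ncard ≤ s) : L1Recovers A x := by
  classical
  intro z hz hne
  set S₀ : Finset κ := {e | x e ≠ 0} with hS₀
  have hcard : #S₀ ≤ s := by
    rw [← Set.ncard_coe_finset]
    convert hx using 2
    ext e; simp [hS₀]
  have hlt := sum_abs_lt_of_mulVec_eq_zero A E hA0 hA1 d hd s hs hdeg hcoll (z - x)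
    (by rw [Matrix.mulVec_sub, hz, sub_self]) (sub_ne_zero.2 hne) S₀ hcard
  rw [← sum_add_sum_compl S₀] at hlt ⊢
  rw [← sum_add_sum_compl S₀ (fun e => |z e|)]
  have h1 : ∑ e ∈ S₀ᶜ, |x e| = 0 := sum_eq_zero fun e he => by
    have : x e = 0 := by simpa [hS₀] using he
    simp [this]
  have h2 : ∑ e ∈ S₀ᶜ, |(z - x) e| = ∑ e ∈ S₀ᶜ, |z e| := sum_congr rfl fun e he => by
    have : x e = 0 := by simpa [hS₀] using he
    simp [this]
  have h3 : ∑ e ∈ S₀, |x e| ≤ ∑ e ∈ S₀, |z e| + ∑ e ∈ S₀, |(z - x) e| := by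
    rw [← sum_add_distrib]
    refine sum_le_sum fun e _ => ?_
    have := abs_sub (z e) (z e - x e)
    simpa using this
  linarith

end GraphCS

/-! ### Moments of the number of hits of an edge set by a random walk -/

namespace GraphCS

open Finset

variable {V : Type*} [Fintype V] [DecidableEq V]

/-- Expectation of `f` over the random walk with `t` steps started at `u`. -/
noncomputable def walkExp (G : SimpleGraph V) [DecidableRel G.Adj] (t : ℕ)
    (f : (Fin (t + 1) → V) → ℝ) (u : V) : ℝ :=
  ∑ w : Fin t → V, (∏ i : Fin t,
    stepMatrix G ((Fin.cons u w : Fin (t + 1) → V) i.castSucc)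
      ((Fin.cons u w : Fin (t + 1) → V) i.succ)) * f (Fin.cons u w)

/-- Number of steps of `w` along an edge of `S`. -/
def stepCount (S : Finset (Sym2 V)) {t : ℕ} (w : Fin (t + 1) → V) : ℕ :=
  #{i : Fin t | s(w i.castSucc, w i.succ) ∈ S}

/-- Probability that the step from `u` is along an edge of `S`. -/
noncomputable def hitProb (G : SimpleGraph V) [DecidableRel G.Adj] (S : Finset (Sym2 V))
    (u : V) : ℝ :=
  ∑ v, stepMatrix G u v * if s(u, v) ∈ S then 1 else 0

/-- Expected number of steps along edges of `S` among the first `t` steps from `u`. -/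
noncomputable def expCount (G : SimpleGraph V) [DecidableRel G.Adj] (S : Finset (Sym2 V)) (t : ℕ)
    (u : V) : ℝ :=
  ∑ j ∈ range t, ((stepMatrix G ^ j).mulVec (hitProb G S)) u

variable (G : SimpleGraph V) [DecidableRel G.Adj] {t : ℕ}

theorem stepMatrix_nonneg (u v : V) : 0 ≤ stepMatrix G u v := by
  simp only [stepMatrix, Matrix.of_apply]
  positivity

theorem stepMatrix_row_sum (hG : ∀ v, 0 < G.degree v) (u : V) : ∑ v, stepMatrix G u v = 1 := by
  simp only [stepMatrix, Matrix.of_apply]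
  rw [← sum_filter, sum_const, ← SimpleGraph.neighborFinset_eq_filter,
    SimpleGraph.card_neighborFinset_eq_degree, nsmul_eq_mul, mul_one_div_cancel]
  exact_mod_cast (hG u).ne'

theorem hitProb_nonneg (S : Finset (Sym2 V)) (u : V) : 0 ≤ hitProb G S u :=
  sum_nonneg fun v _ => mul_nonneg (stepMatrix_nonneg G u v) (by split_ifs <;> simp)

theorem walkExp_zero (f : (Fin 1 → V) → ℝ) (u : V) :
    walkExp G 0 f u = f (Fin.cons u Fin.elim0) := by
  simp only [walkExp, univ_eq_empty, prod_empty, one_mul]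
  rw [Fintype.sum_unique]
  congr 2

theorem walkExp_succ (f : (Fin (t + 2) → V) → ℝ) (u : V) :
    walkExp G (t + 1) f u
      = ∑ v, stepMatrix G u v * walkExp G t (fun w => f (Fin.cons u w)) v := by
  simp only [walkExp, mul_sum]
  rw [← (Fin.consEquiv fun _ : Fin (t + 1) => V).sum_comp, Fintype.sum_prod_type]
  refine sum_congr rfl fun v _ => sum_congr rfl fun w _ => ?_
  rw [Fin.prod_univ_succ, ← mul_assoc]
  simp [Fin.consEquiv, Fin.castSucc_succ]

theorem walkExp_congr {f g : (Fin (t + 1) → V) → ℝ} (u : V)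
    (h : ∀ w, w 0 = u → f w = g w) : walkExp G t f u = walkExp G t g u :=
  sum_congr rfl fun _ _ => by rw [h _ (Fin.cons_zero ..)]

theorem walkExp_mono {f g : (Fin (t + 1) → V) → ℝ} (h : ∀ w, f w ≤ g w) (u : V) :
    walkExp G t f u ≤ walkExp G t g u :=
  sum_le_sum fun _ _ => mul_le_mul_of_nonneg_left (h _)
    (prod_nonneg fun _ _ => stepMatrix_nonneg G _ _)

theorem walkExp_const_mul (a : ℝ) (f : (Fin (t + 1) → V) → ℝ) (u : V) :
    walkExp G t (fun w => a * f w) u = a * walkExp G t f u := by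
  simp only [walkExp, mul_sum]
  exact sum_congr rfl fun w _ => by ring

theorem walkExp_one (hG : ∀ v, 0 < G.degree v) (u : V) :
    walkExp G t (fun _ => 1) u = 1 := by
  induction t generalizing u with
  | zero => rw [walkExp_zero]
  | succ t ih => rw [walkExp_succ]; simp [ih, stepMatrix_row_sum G hG]

theorem sum_goodStartProb_mul (f : (Fin (t + 1) → V) → ℝ) :
    ∑ w, goodStartProb G w * f w = ∑ u, stationary G u * walkExp G t f u := by
  simp only [walkExp, mul_sum]
  rw [← (Fin.consEquiv fun _ : Fin (t + 1) => V).sum_comp, Fintype.sum_prod_type]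
  refine sum_congr rfl fun v _ => sum_congr rfl fun w _ => ?_
  simp [goodStartProb, Fin.consEquiv, mul_assoc]

theorem stepCount_cons (S : Finset (Sym2 V)) (u : V) (w : Fin (t + 1) → V) :
    stepCount S (Fin.cons u w : Fin (t + 2) → V)
      = (if s(u, w 0) ∈ S then 1 else 0) + stepCount S w := by
  simp only [stepCount, card_filter]
  rw [Fin.sum_univ_succ]
  simp [Fin.castSucc_succ]

theorem expCount_succ (S : Finset (Sym2 V)) (t : ℕ) (u : V) :
    expCount G S (t + 1) u = hitProb G S u + ∑ v, stepMatrix G u v * expCount G S t v := by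
  simp only [expCount]
  rw [sum_range_succ', add_comm]
  congr 1
  · simp
  · simp_rw [mul_sum]
    rw [sum_comm]
    refine sum_congr rfl fun j _ => ?_
    rw [pow_succ', ← Matrix.mulVec_mulVec]
    rfl

/-- Splitting a function of the walk at its first step, for functions that depend on the first
step only through whether it is along an edge of `S`. -/
theorem walkExp_succ_split (S : Finset (Sym2 V)) (f : (Fin (t + 2) → V) → ℝ)
    (g h : (Fin (t + 1) → V) → ℝ)
    (hg : ∀ u w, s(u, w 0) ∈ S → f (Fin.cons u w) = g w)
    (hh : ∀ u w, s(u, w 0) ∉ S → f (Fin.cons u w) = h w) (u : V) :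
    walkExp G (t + 1) f u = ∑ v, stepMatrix G u v *
      (walkExp G t h v + (if s(u, v) ∈ S then 1 else 0) * (walkExp G t g v - walkExp G t h v)) := by
  rw [walkExp_succ]
  refine sum_congr rfl fun v _ => ?_
  congr 1
  split_ifs with hS
  · rw [walkExp_congr G v (g := g) fun w hw => hg u w (by rw [hw]; exact hS)]; ring
  · rw [walkExp_congr G v (g := h) fun w hw => hh u w (by rw [hw]; exact hS)]; ring

/-- Inductive step of both moment bounds: `b` is the extra gain when the first step hits `S`. -/
theorem sum_stepMatrix_mul_le (S : Finset (Sym2 V)) (a b : V → ℝ) (β : ℝ) (hb : ∀ v, b v ≤ β)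
    (u : V) :
    ∑ v, stepMatrix G u v * (a v + (if s(u, v) ∈ S then 1 else 0) * b v)
      ≤ ∑ v, stepMatrix G u v * a v + β * hitProb G S u := by
  rw [hitProb, mul_sum, ← sum_add_distrib]
  refine sum_le_sum fun v _ => ?_
  have h0 : 0 ≤ stepMatrix G u v * (if s(u, v) ∈ S then 1 else 0) :=
    mul_nonneg (stepMatrix_nonneg G u v) (by split_ifs <;> simp)
  have := mul_le_mul_of_nonneg_left (hb v) h0
  linarith

variable {G}

theorem sum_stepMatrix_mul_one_add (hG : ∀ v, 0 < G.degree v) (S : Finset (Sym2 V)) (a : ℝ)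
    (t : ℕ) (u : V) :
    ∑ v, stepMatrix G u v * (1 + a * expCount G S t v) + a * hitProb G S u
      = 1 + a * expCount G S (t + 1) u := by
  rw [expCount_succ]
  simp_rw [mul_add, sum_add_distrib, mul_one, stepMatrix_row_sum G hG, mul_left_comm _ a,
    ← mul_sum]
  ring

/-- A hit doubles the remaining moment, a gain of at most `1 + 2 * ρ ≤ 2`. -/
theorem walkExp_two_pow_stepCount_le (hG : ∀ v, 0 < G.degree v) (S : Finset (Sym2 V)) {ρ : ℝ}
    (hρ : ρ ≤ 1 / 2) {t₀ : ℕ} (h : ∀ t ≤ t₀, ∀ u, expCount G S t u ≤ ρ) {t : ℕ} (ht : t ≤ t₀)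
    (u : V) : walkExp G t (fun w => (2 : ℝ) ^ stepCount S w) u ≤ 1 + 2 * expCount G S t u := by
  induction t generalizing u with
  | zero => rw [walkExp_zero]; simp [stepCount, expCount]
  | succ t ih =>
    have ih' := fun u => ih (by omega) u
    rw [walkExp_succ_split G S _ (fun w => 2 * (2 : ℝ) ^ stepCount S w)
      (fun w => (2 : ℝ) ^ stepCount S w)
      (fun u w hw => by rw [stepCount_cons, if_pos hw, pow_add, pow_one])
      (fun u w hw => by rw [stepCount_cons, if_neg hw, zero_add])]
    simp_rw [walkExp_const_mul]
    refine (sum_stepMatrix_mul_le G S _ _ 2 (fun v => ?_) u).trans ?_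
    · have := ih' v
      have := h t (by omega) v
      linarith
    · rw [← sum_stepMatrix_mul_one_add hG]
      gcongr with v
      · exact stepMatrix_nonneg G u v
      · exact ih' v

/-- The exponent is truncated, so the first hit is free: it only replaces `2 ^ (N - 1)` by `2 ^ N`
for the remaining count `N`, a gain of at most `2 * ρ`. This extra factor `ρ` makes collisions much
rarer than hits. -/
theorem walkExp_two_pow_stepCount_sub_one_le (hG : ∀ v, 0 < G.degree v) (S : Finset (Sym2 V))
    {ρ : ℝ} (hρ : ρ ≤ 1 / 2) {t₀ : ℕ} (h : ∀ t ≤ t₀, ∀ u, expCount G S t u ≤ ρ) {t : ℕ}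
    (ht : t ≤ t₀) (u : V) : walkExp G t (fun w => (2 : ℝ) ^ (stepCount S w - 1)) u
      ≤ 1 + 2 * ρ * expCount G S t u := by
  induction t generalizing u with
  | zero => rw [walkExp_zero]; simp [stepCount, expCount]
  | succ t ih =>
    have ih' := fun u => ih (by omega) u
    rw [walkExp_succ_split G S _ (fun w => (2 : ℝ) ^ stepCount S w)
      (fun w => (2 : ℝ) ^ (stepCount S w - 1))
      (fun u w hw => by rw [stepCount_cons, if_pos hw, Nat.add_sub_cancel_left])
      (fun u w hw => by rw [stepCount_cons, if_neg hw, zero_add])]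
    refine (sum_stepMatrix_mul_le G S _ _ (2 * ρ) (fun v => ?_) u).trans ?_
    · have h1 := walkExp_two_pow_stepCount_le hG S hρ h (show t ≤ t₀ by omega) v
      have h2 := h t (by omega) v
      have h3 : 1 ≤ walkExp G t (fun w => (2 : ℝ) ^ (stepCount S w - 1)) v := by
        conv_lhs => rw [← walkExp_one (t := t) G hG v]
        exact walkExp_mono G (fun _ => one_le_pow₀ (by norm_num)) v
      linarith
    · rw [← sum_stepMatrix_mul_one_add hG]
      gcongr with v
      · exact stepMatrix_nonneg G u v
      · exact ih' v

/-- Once the first hit has occurred, at most `ρ` further hits are expected. -/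
theorem expCount_le_mul_walkExp_visit (S : Finset (Sym2 V))
    {ρ : ℝ} {t₀ : ℕ} (h : ∀ t ≤ t₀, ∀ u, expCount G S t u ≤ ρ) {t : ℕ}
    (ht : t ≤ t₀) (hG : ∀ v, 0 < G.degree v) (u : V) : expCount G S t u
      ≤ (1 + ρ) * walkExp G t (fun w => if stepCount S w = 0 then 0 else 1) u := by
  induction t generalizing u with
  | zero => rw [walkExp_zero]; simp [stepCount, expCount]
  | succ t ih =>
    have ih' := fun u => ih (by omega) u
    rw [walkExp_succ_split G S _ (fun w => 1)
      (fun w => if stepCount S w = 0 then 0 else 1)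
      (fun u w hw => by rw [stepCount_cons, if_pos hw, if_neg (by omega)])
      (fun u w hw => by rw [stepCount_cons, if_neg hw, zero_add])]
    rw [expCount_succ, hitProb, ← sum_add_distrib, mul_sum]
    refine sum_le_sum fun v _ => ?_
    rw [← mul_add, mul_left_comm]
    refine mul_le_mul_of_nonneg_left ?_ (stepMatrix_nonneg G u v)
    rw [walkExp_one G hG]
    have h1 := ih' v
    have h2 := h t (by omega) v
    split_ifs <;> linarith

end GraphCS

/-! ### Expected hits: stationarity and mixing -/

namespace GraphCS

open Finset

variable {V : Type*} [Fintype V] [DecidableEq V] {G : SimpleGraph V} [DecidableRel G.Adj]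

theorem card_filter_mk_mem_le (S : Finset (Sym2 V)) (u : V) : #{v | s(u, v) ∈ S} ≤ #S := by
  refine card_le_card_of_injOn (fun v => s(u, v)) (fun v hv => by simpa using hv) ?_
  intro v _ w _ h
  exact Sym2.congr_right.1 h

theorem card_filter_prod_mk_mem {S : Finset (Sym2 V)} (hS : S ⊆ G.edgeFinset) :
    #{p : V × V | s(p.1, p.2) ∈ S} = 2 * #S := by
  rw [card_eq_sum_card_fiberwise (f := fun p : V × V => s(p.1, p.2)) (t := S)
    (fun p hp => by simpa using hp), mul_comm, ← smul_eq_mul, ← sum_const]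
  refine sum_congr rfl fun e he => ?_
  have hE := hS he
  induction e with
  | _ a b =>
    have hab : a ≠ b := by
      rw [SimpleGraph.mem_edgeFinset, SimpleGraph.mem_edgeSet] at hE
      exact hE.ne
    have : ({p ∈ {p : V × V | s(p.1, p.2) ∈ S} | s(p.1, p.2) = s(a, b)} : Finset (V × V))
        = {(a, b), (b, a)} := by
      ext ⟨x, y⟩
      simp only [mem_filter, mem_univ, true_and, mem_insert, mem_singleton, Prod.mk.injEq,
        Sym2.eq_iff]
      constructor
      · exact fun h => h.2
      · rintro (⟨rfl, rfl⟩ | ⟨rfl, rfl⟩)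
        · exact ⟨he, Or.inl ⟨rfl, rfl⟩⟩
        · exact ⟨Sym2.eq_swap ▸ he, Or.inr ⟨rfl, rfl⟩⟩
    rw [this, card_pair (by simp [hab])]

theorem stepMatrix_le {D : ℕ} (hD : 0 < D) (hdeg : ∀ v, D ≤ G.degree v) (u v : V) :
    stepMatrix G u v ≤ 1 / D := by
  have hD' : (0 : ℝ) < D := by exact_mod_cast hD
  simp only [stepMatrix, Matrix.of_apply]
  split_ifs
  · exact one_div_le_one_div_of_le hD' (by exact_mod_cast hdeg u)
  · positivity

theorem hitProb_le {D : ℕ} (hD : 0 < D) (hdeg : ∀ v, D ≤ G.degree v) (S : Finset (Sym2 V))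
    (u : V) : hitProb G S u ≤ #S / D := by
  calc hitProb G S u ≤ ∑ v, 1 / (D : ℝ) * if s(u, v) ∈ S then 1 else 0 :=
        sum_le_sum fun v _ => mul_le_mul_of_nonneg_right (stepMatrix_le hD hdeg u v)
          (by split_ifs <;> simp)
    _ = 1 / D * #{v | s(u, v) ∈ S} := by rw [← mul_sum, sum_boole]
    _ ≤ 1 / D * #S := by
        gcongr
        exact_mod_cast card_filter_mk_mem_le S u
    _ = #S / D := by ring

theorem sum_hitProb_le {D : ℕ} (hD : 0 < D) (hdeg : ∀ v, D ≤ G.degree v) {S : Finset (Sym2 V)}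
    (hS : S ⊆ G.edgeFinset) : ∑ u, hitProb G S u ≤ 2 * #S / D := by
  calc ∑ u, hitProb G S u ≤ ∑ u, ∑ v, 1 / (D : ℝ) * if s(u, v) ∈ S then 1 else 0 :=
        sum_le_sum fun u _ => sum_le_sum fun v _ =>
          mul_le_mul_of_nonneg_right (stepMatrix_le hD hdeg u v) (by split_ifs <;> simp)
    _ = 1 / D * #{p : V × V | s(p.1, p.2) ∈ S} := by
        rw [← sum_boole, mul_sum, Fintype.sum_prod_type]
    _ = 2 * #S / D := by
        rw [card_filter_prod_mk_mem hS]; push_cast; ring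

/-- A stationary step is uniform over the `2 * |E|` oriented edges. -/
theorem sum_stationary_mul_hitProb (hG : ∀ v, 0 < G.degree v) {S : Finset (Sym2 V)}
    (hS : S ⊆ G.edgeFinset) : ∑ u, stationary G u * hitProb G S u = #S / numEdges G := by
  calc ∑ u, stationary G u * hitProb G S u
      = ∑ u, ∑ v, 1 / (2 * numEdges G : ℝ) * if s(u, v) ∈ S then 1 else 0 := by
        refine sum_congr rfl fun u _ => ?_
        rw [hitProb, mul_sum]
        refine sum_congr rfl fun v _ => ?_
        split_ifs with h
        · have hadj : G.Adj u v := by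
            rw [← SimpleGraph.mem_edgeSet, ← SimpleGraph.mem_edgeFinset]; exact hS h
          have : (G.degree u : ℝ) ≠ 0 := by exact_mod_cast (hG u).ne'
          simp only [stepMatrix, stationary, Matrix.of_apply, if_pos hadj]
          field_simp
        · simp
    _ = 1 / (2 * numEdges G : ℝ) * #{p : V × V | s(p.1, p.2) ∈ S} := by
        rw [← sum_boole, mul_sum, Fintype.sum_prod_type]
    _ = #S / numEdges G := by
        rw [card_filter_prod_mk_mem hS]; push_cast
        rw [div_mul_eq_mul_div, one_mul, mul_div_mul_left _ _ two_ne_zero]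

theorem sum_stationary_mul_stepMatrix (hG : ∀ v, 0 < G.degree v) (v : V) :
    ∑ u, stationary G u * stepMatrix G u v = stationary G v := by
  have h : ∀ u, stationary G u * stepMatrix G u v
      = if G.Adj v u then 1 / (2 * numEdges G : ℝ) else 0 := by
    intro u
    have : (G.degree u : ℝ) ≠ 0 := by exact_mod_cast (hG u).ne'
    simp only [stepMatrix, stationary, Matrix.of_apply, G.adj_comm v u]
    split_ifs
    · field_simp
    · simp
  simp_rw [h]
  rw [← sum_filter, sum_const, ← SimpleGraph.neighborFinset_eq_filter,
    SimpleGraph.card_neighborFinset_eq_degree, nsmul_eq_mul, stationary]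
  ring

theorem sum_stationary (hE : 0 < numEdges G) : ∑ u, stationary G u = 1 := by
  have h : (∑ v, (G.degree v : ℝ)) = 2 * numEdges G := by
    exact_mod_cast G.sum_degrees_eq_twice_card_edges
  have : (0 : ℝ) < numEdges G := by exact_mod_cast hE
  simp only [stationary]
  rw [← sum_div, h, div_self (by positivity)]

theorem sum_stationary_mul_mulVec (hG : ∀ v, 0 < G.degree v) (f : V → ℝ) (j : ℕ) :
    ∑ u, stationary G u * ((stepMatrix G ^ j).mulVec f) u = ∑ u, stationary G u * f u := by
  induction j with
  | zero => simp
  | succ j ih =>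
    rw [← ih, pow_succ', ← Matrix.mulVec_mulVec]
    set g := (stepMatrix G ^ j).mulVec f
    simp only [Matrix.mulVec, dotProduct, mul_sum]
    rw [sum_comm]
    refine sum_congr rfl fun v _ => ?_
    rw [← sum_stationary_mul_stepMatrix hG v, sum_mul]
    exact sum_congr rfl fun u _ => by ring

theorem sum_stationary_mul_expCount (hG : ∀ v, 0 < G.degree v) {S : Finset (Sym2 V)}
    (hS : S ⊆ G.edgeFinset) (t : ℕ) :
    ∑ u, stationary G u * expCount G S t u = t * (#S / numEdges G) := by
  simp only [expCount, mul_sum]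
  rw [sum_comm]
  simp [sum_stationary_mul_mulVec hG, sum_stationary_mul_hitProb hG hS]

/-- Closeness persists after time `T`: each row of the next power is a convex combination of rows of
the current one. -/
theorem abs_pow_sub_stationary_le (hG : ∀ v, 0 < G.degree v) {δ : ℝ} {T : ℕ}
    (hT : ∀ u v, |(stepMatrix G ^ T) u v - stationary G v| ≤ δ) {s : ℕ} (hs : T ≤ s) :
    ∀ u v, |(stepMatrix G ^ s) u v - stationary G v| ≤ δ := by
  induction s, hs using Nat.le_induction with
  | base => exact hT
  | succ s _ ih =>
    intro u v
    have h : (stepMatrix G ^ (s + 1)) u v - stationary G v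
        = ∑ w, stepMatrix G u w * ((stepMatrix G ^ s) w v - stationary G v) := by
      simp_rw [mul_sub, sum_sub_distrib]
      rw [← sum_mul, stepMatrix_row_sum G hG, one_mul, pow_succ', Matrix.mul_apply]
    rw [h]
    calc |∑ w, stepMatrix G u w * ((stepMatrix G ^ s) w v - stationary G v)|
        ≤ ∑ w, stepMatrix G u w * δ := by
          refine (abs_sum_le_sum_abs _ _).trans (sum_le_sum fun w _ => ?_)
          rw [abs_mul, abs_of_nonneg (stepMatrix_nonneg G u w)]
          exact mul_le_mul_of_nonneg_left (ih w v) (stepMatrix_nonneg G u w)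
      _ = δ := by rw [← sum_mul, stepMatrix_row_sum G hG, one_mul]

theorem pow_mulVec_le (hG : ∀ v, 0 < G.degree v) {f : V → ℝ} {β : ℝ} (hf : ∀ v, f v ≤ β) (j : ℕ)
    (u : V) : ((stepMatrix G ^ j).mulVec f) u ≤ β := by
  induction j generalizing u with
  | zero => simpa using hf u
  | succ j ih =>
    rw [pow_succ', ← Matrix.mulVec_mulVec]
    calc ∑ v, stepMatrix G u v * ((stepMatrix G ^ j).mulVec f) v
        ≤ ∑ v, stepMatrix G u v * β :=
          sum_le_sum fun v _ => mul_le_mul_of_nonneg_left (ih v) (stepMatrix_nonneg G u v)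
      _ = β := by rw [← sum_mul, stepMatrix_row_sum G hG, one_mul]

/-- Each of the first `T` steps hits `S` with probability at most `#S / D`, wherever the walk is.
Later steps are nearly stationary, and by `hδ` the mixing error costs at most another `#S / |E|`. -/
theorem expCount_le {D : ℕ} (hD : 0 < D) (hdeg : ∀ v, D ≤ G.degree v) {δ : ℝ} {T : ℕ}
    (hT : ∀ u v, |(stepMatrix G ^ T) u v - stationary G v| ≤ δ) (hE : 0 < numEdges G)
    (hδ : 2 * δ * numEdges G ≤ D) {S : Finset (Sym2 V)} (hS : S ⊆ G.edgeFinset) {t t₀ : ℕ}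
    (ht : t ≤ t₀) (u : V) :
    expCount G S t u ≤ T * (#S / D) + t₀ * (2 * (#S / numEdges G)) := by
  have hG : ∀ v, 0 < G.degree v := fun v => hD.trans_le (hdeg v)
  have hD' : (0 : ℝ) < D := by exact_mod_cast hD
  have hE' : (0 : ℝ) < numEdges G := by exact_mod_cast hE
  have hδ0 : 0 ≤ δ := (abs_nonneg _).trans (hT u u)
  have hterm : ∀ j, ((stepMatrix G ^ j).mulVec (hitProb G S)) u
      ≤ (if j < T then (#S / D : ℝ) else 0) + 2 * (#S / numEdges G) := by
    intro j
    split_ifs with hj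
    · have := pow_mulVec_le hG (hitProb_le hD hdeg S) j u
      have : (0 : ℝ) ≤ 2 * (#S / numEdges G) := by positivity
      linarith
    · calc ∑ v, (stepMatrix G ^ j) u v * hitProb G S v
          ≤ ∑ v, (stationary G v + δ) * hitProb G S v := by
            refine sum_le_sum fun v _ => mul_le_mul_of_nonneg_right ?_ (hitProb_nonneg G S v)
            have := (abs_le.1 (abs_pow_sub_stationary_le hG hT (not_lt.1 hj) u v)).2
            linarith
        _ = #S / numEdges G + δ * ∑ v, hitProb G S v := by
            simp_rw [add_mul, sum_add_distrib]
            rw [sum_stationary_mul_hitProb hG hS, mul_sum]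
        _ ≤ #S / numEdges G + δ * (2 * #S / D) := by
            gcongr
            exact sum_hitProb_le hD hdeg hS
        _ ≤ 0 + 2 * (#S / numEdges G) := by
            have : δ * (2 * #S / D) ≤ #S / numEdges G := by
              rw [mul_div_assoc', div_le_div_iff₀ hD' hE']
              have := mul_le_mul_of_nonneg_left hδ (Nat.cast_nonneg (α := ℝ) #S)
              linarith
            linarith
  calc expCount G S t u
      ≤ ∑ j ∈ range t, ((if j < T then (#S / D : ℝ) else 0) + 2 * (#S / numEdges G)) :=
        sum_le_sum fun j _ => hterm j
    _ = #{j ∈ range t | j < T} * (#S / D : ℝ) + t * (2 * (#S / numEdges G)) := by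
        rw [sum_add_distrib, ← sum_filter, sum_const, sum_const, card_range, nsmul_eq_mul,
          nsmul_eq_mul]
    _ ≤ T * (#S / D) + t₀ * (2 * (#S / numEdges G)) := by
        have : #{j ∈ range t | j < T} ≤ T := by
          refine (card_le_card (t := range T) fun j hj => ?_).trans (card_range T).le
          simp only [mem_filter, mem_range] at hj ⊢
          exact hj.2
        gcongr

variable {t : ℕ} {S : Finset (Sym2 V)} {ρ : ℝ}

theorem sum_goodStartProb_two_pow_le (hG : ∀ v, 0 < G.degree v) (hE : 0 < numEdges G)
    (hS : S ⊆ G.edgeFinset) (hρ : ρ ≤ 1 / 2) (h : ∀ t' ≤ t, ∀ u, expCount G S t' u ≤ ρ) :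
    ∑ w : Fin (t + 1) → V, goodStartProb G w * (2 : ℝ) ^ (stepCount S w - 1)
      ≤ 1 + 2 * ρ * (t * (#S / numEdges G)) := by
  rw [sum_goodStartProb_mul, ← sum_stationary_mul_expCount hG hS t, ← sum_stationary hE, mul_sum,
    ← sum_add_distrib]
  refine sum_le_sum fun u _ => ?_
  have h0 : 0 ≤ stationary G u := by unfold stationary; positivity
  have := mul_le_mul_of_nonneg_left
    (walkExp_two_pow_stepCount_sub_one_le hG S hρ h le_rfl u) h0
  linarith

theorem le_sum_goodStartProb_visit (hG : ∀ v, 0 < G.degree v)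
    (hS : S ⊆ G.edgeFinset) (h : ∀ t' ≤ t, ∀ u, expCount G S t' u ≤ ρ) :
    t * (#S / numEdges G) ≤ (1 + ρ) *
      ∑ w : Fin (t + 1) → V, goodStartProb G w * (if stepCount S w = 0 then 0 else 1) := by
  rw [sum_goodStartProb_mul, ← sum_stationary_mul_expCount hG hS t, mul_sum]
  refine sum_le_sum fun u _ => ?_
  have h0 : 0 ≤ stationary G u := by unfold stationary; positivity
  have := mul_le_mul_of_nonneg_left (expCount_le_mul_walkExp_visit S h le_rfl hG u) h0
  linarith

theorem sum_goodStartProb (hG : ∀ v, 0 < G.degree v) (hE : 0 < numEdges G) :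
    ∑ w : Fin (t + 1) → V, goodStartProb G w = 1 := by
  have := sum_goodStartProb_mul G (t := t) (fun _ => 1)
  simpa [walkExp_one G hG, sum_stationary hE] using this

end GraphCS

/-! ### Chernoff bounds and the union bound -/

namespace GraphCS

open Finset MeasureTheory ProbabilityTheory

variable {n m t : ℕ} {G : SimpleGraph (Fin n)} [DecidableRel G.Adj] {Ω : Type*}
  [MeasurableSpace Ω] {P : Measure Ω} [IsProbabilityMeasure P]

theorem IsGoodStartWalk.measurable {W : Ω → Fin (t + 1) → Fin n} (hW : IsGoodStartWalk G P W) :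
    Measurable W :=
  measurable_to_countable' fun w => (hW w).1

theorem IsGoodStartWalk.integral_comp {W : Ω → Fin (t + 1) → Fin n} (hW : IsGoodStartWalk G P W)
    (f : (Fin (t + 1) → Fin n) → ℝ) :
    ∫ ω, f (W ω) ∂P = ∑ w, goodStartProb G w * f w := by
  have hm := hW.measurable
  have : IsProbabilityMeasure (P.map W) := Measure.isProbabilityMeasure_map hm.aemeasurable
  rw [← integral_map (f := f) hm.aemeasurable
    (Measurable.of_discrete.aestronglyMeasurable), integral_fintype .of_finite]
  refine sum_congr rfl fun w _ => ?_
  rw [map_measureReal_apply hm (measurableSet_singleton w), ← (hW w).2, smul_eq_mul]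
  rfl

/-- Markov's inequality for a product of independent factors. -/
theorem measureReal_le_prod_le {W : Fin m → Ω → Fin (t + 1) → Fin n}
    (hW : ∀ i, IsGoodStartWalk G P (W i)) (hind : iIndepFun W P)
    (g : (Fin (t + 1) → Fin n) → ℝ) (hg : ∀ w, 0 ≤ g w) {x : ℝ} (hx : 0 < x) :
    P.real {ω | x ≤ ∏ i, g (W i ω)} ≤ (∑ w, goodStartProb G w * g w) ^ m / x := by
  have hint : Integrable (fun ω => ∏ i, g (W i ω)) P := by
    have hF : Measurable fun ω i => W i ω := measurable_pi_lambda _ fun i => (hW i).measurable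
    have := Integrable.of_finite (μ := P.map fun ω i => W i ω)
      (f := fun w : Fin m → Fin (t + 1) → Fin n => ∏ i, g (w i))
    exact this.comp_measurable hF
  have h1 := mul_meas_ge_le_integral_of_nonneg
    (ae_of_all P fun ω => prod_nonneg fun i _ => hg (W i ω)) hint x
  rw [hind.integral_fun_prod_comp (f := fun _ => g) (fun i => (hW i).measurable.aemeasurable)
    (fun i => Measurable.of_discrete.aestronglyMeasurable)] at h1
  simp_rw [fun i => (hW i).integral_comp g] at h1
  rw [prod_const, card_univ, Fintype.card_fin] at h1
  rwa [le_div_iff₀ hx, mul_comm]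

variable {W : Fin m → Ω → Fin (t + 1) → Fin n}

/-- With high probability every edge is visited by many of the walks. -/
theorem measureReal_few_visits_le (hW : ∀ i, IsGoodStartWalk G P (W i)) (hind : iIndepFun W P)
    (hG : ∀ v, 0 < G.degree v) (hE : 0 < numEdges G) {e : Sym2 (Fin n)} (he : e ∈ G.edgeFinset)
    (h : ∀ t' ≤ t, ∀ u, expCount G {e} t' u ≤ 1 / 2000) {r : ℝ}
    (hr : r / 2 ≤ t / numEdges G) (hr0 : 0 ≤ r) {l : ℝ} (hl : 4000 * l ≤ m * r) :
    P.real {ω | (#{i | stepCount {e} (W i ω) ≠ 0} : ℝ) < m * r / 16} ≤ Real.exp (-(4 * l)) := by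
  set p := ∑ w : Fin (t + 1) → Fin n, goodStartProb G w * (if stepCount {e} w = 0 then 0 else 1)
    with hp
  have hpr : r / 4 ≤ p := by
    have := le_sum_goodStartProb_visit hG (singleton_subset_iff.2 he) h
    rw [← hp, card_singleton, Nat.cast_one, mul_one_div] at this
    linarith
  -- Lower-tail Chernoff bound: each visiting walk contributes a factor `1 / 2`.
  set g : (Fin (t + 1) → Fin n) → ℝ := fun w => if stepCount {e} w = 0 then 1 else 1 / 2 with hg
  have hsum : ∑ w, goodStartProb G w * g w = 1 - p / 2 := by
    rw [← sum_goodStartProb (t := t) hG hE, hp, sum_div, ← sum_sub_distrib]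
    refine sum_congr rfl fun w _ => ?_
    simp only [hg]
    split_ifs <;> ring
  have hg0 : ∀ w, 0 ≤ g w := fun w => by simp only [hg]; split_ifs <;> norm_num
  have hprod : ∀ ω, ∏ i, g (W i ω)
      = Real.exp (-(Real.log 2 * (#{i | stepCount {e} (W i ω) ≠ 0} : ℝ))) := by
    intro ω
    have h2 : ∏ i, g (W i ω) = (1 / 2) ^ #{i | stepCount {e} (W i ω) ≠ 0} := by
      rw [← prod_const, prod_filter]
      refine prod_congr rfl fun i _ => ?_
      simp only [hg, ne_eq, ite_not]
    rw [h2, Real.exp_neg, mul_comm, Real.exp_nat_mul, Real.exp_log two_pos, one_div, inv_pow]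
  have hlog : 0 < Real.log 2 := Real.log_pos one_lt_two
  have hlog2 := Real.log_two_lt_d9
  calc P.real {ω | (#{i | stepCount {e} (W i ω) ≠ 0} : ℝ) < m * r / 16}
      ≤ P.real {ω | Real.exp (-(Real.log 2 * (m * r / 16))) ≤ ∏ i, g (W i ω)} := by
        refine measureReal_mono fun ω hω => ?_
        have hω' : (#{i | stepCount {e} (W i ω) ≠ 0} : ℝ) < m * r / 16 := hω
        rw [Set.mem_ofPred_eq, hprod, Real.exp_le_exp]
        exact neg_le_neg (mul_le_mul_of_nonneg_left hω'.le hlog.le)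
    _ ≤ (1 - p / 2) ^ m / Real.exp (-(Real.log 2 * (m * r / 16))) := by
        rw [← hsum]
        exact measureReal_le_prod_le hW hind g hg0 (Real.exp_pos _)
    _ ≤ Real.exp (-(p / 2)) ^ m / Real.exp (-(Real.log 2 * (m * r / 16))) := by
        have h0 : 0 ≤ 1 - p / 2 := by
          rw [← hsum]
          refine sum_nonneg fun w _ => mul_nonneg ?_ (hg0 w)
          exact mul_nonneg (by unfold stationary; positivity)
            (prod_nonneg fun _ _ => stepMatrix_nonneg G _ _)
        gcongr
        linarith [Real.add_one_le_exp (-(p / 2))]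
    _ = Real.exp (m * (-(p / 2)) + Real.log 2 * (m * r / 16)) := by
        rw [← Real.exp_nat_mul, ← Real.exp_sub, sub_neg_eq_add]
    _ ≤ Real.exp (-(4 * l)) := by
        rw [Real.exp_le_exp]
        -- The exponent is at most `(0.7 / 16 - 1 / 8) * m * r`, well below `-(m * r) / 1000 ≤ -(4 *
        -- l)`.
        have h1 := mul_le_mul_of_nonneg_left hpr (Nat.cast_nonneg (α := ℝ) m)
        have hmr : 0 ≤ m * r := by positivity
        have h2 : Real.log 2 * (m * r) ≤ 0.7 * (m * r) :=
          mul_le_mul_of_nonneg_right (by linarith) hmr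
        linarith

/-- The visits of the walks to the edges of a small set rarely collide. -/
theorem measureReal_many_collisions_le (hW : ∀ i, IsGoodStartWalk G P (W i))
    (hind : iIndepFun W P)
    (hG : ∀ v, 0 < G.degree v) (hE : 0 < numEdges G) {S : Finset (Sym2 (Fin n))}
    (hS : S ⊆ G.edgeFinset)
    (h : ∀ t' ≤ t, ∀ u, expCount G S t' u ≤ 1 / 2000) {r : ℝ}
    (hr : t / numEdges G ≤ r) (hr0 : 0 ≤ r) {l : ℝ} (hl : 4000 * l ≤ m * r) :
    P.real {ω | m * r / 16 / 16 * #S < ∑ i, ((stepCount S (W i ω) - 1 : ℕ) : ℝ)}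
      ≤ Real.exp (-(4 * l)) ^ #S := by
  set g : (Fin (t + 1) → Fin n) → ℝ := fun w => 2 ^ (stepCount S w - 1) with hg
  have hsum : ∑ w, goodStartProb G w * g w ≤ Real.exp (r * #S / 1000) := by
    refine (sum_goodStartProb_two_pow_le hG hE hS (by norm_num) h).trans ?_
    have h1 := Real.add_one_le_exp (r * #S / 1000)
    have h2 := mul_le_mul_of_nonneg_right hr (Nat.cast_nonneg (α := ℝ) #S)
    rw [div_mul_eq_mul_div, ← mul_div_assoc'] at h2
    linarith
  have hsum0 : 0 ≤ ∑ w, goodStartProb G w * g w :=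
    sum_nonneg fun w _ => mul_nonneg (mul_nonneg (by unfold stationary; positivity)
      (prod_nonneg fun _ _ => stepMatrix_nonneg G _ _)) (by positivity)
  have hprod : ∀ ω, ∏ i, g (W i ω)
      = Real.exp (Real.log 2 * ∑ i, ((stepCount S (W i ω) - 1 : ℕ) : ℝ)) := by
    intro ω
    rw [mul_sum, Real.exp_sum]
    refine prod_congr rfl fun i _ => ?_
    rw [mul_comm, Real.exp_nat_mul, Real.exp_log two_pos]
  have hlog : 0 < Real.log 2 := Real.log_pos one_lt_two
  have hlog2 := Real.log_two_gt_d9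
  calc P.real {ω | m * r / 16 / 16 * #S < ∑ i, ((stepCount S (W i ω) - 1 : ℕ) : ℝ)}
      ≤ P.real {ω | Real.exp (Real.log 2 * (m * r / 16 / 16 * #S)) ≤ ∏ i, g (W i ω)} := by
        refine measureReal_mono fun ω hω => ?_
        have hω' : m * r / 16 / 16 * #S < ∑ i, ((stepCount S (W i ω) - 1 : ℕ) : ℝ) := hω
        rw [Set.mem_ofPred_eq, hprod, Real.exp_le_exp]
        exact mul_le_mul_of_nonneg_left hω'.le hlog.le
    _ ≤ (∑ w, goodStartProb G w * g w) ^ m / Real.exp (Real.log 2 * (m * r / 16 / 16 * #S)) :=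
        measureReal_le_prod_le hW hind g (fun w => by positivity) (Real.exp_pos _)
    _ ≤ Real.exp (r * #S / 1000) ^ m / Real.exp (Real.log 2 * (m * r / 16 / 16 * #S)) := by
        gcongr
    _ = Real.exp (m * (r * #S / 1000) - Real.log 2 * (m * r / 16 / 16 * #S)) := by
        rw [← Real.exp_nat_mul, ← Real.exp_sub]
    _ ≤ Real.exp (-(4 * l)) ^ #S := by
        rw [← Real.exp_nat_mul, Real.exp_le_exp]
        -- The gain `0.69 / 256 > 0.0026` exceeds the cost `0.001` of the moment by more than the
        -- required `0.001`.
        have hmr : 0 ≤ m * r * #S := by positivity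
        have h1 : 0.69 * (m * r * #S) ≤ Real.log 2 * (m * r * #S) :=
          mul_le_mul_of_nonneg_right (by linarith) hmr
        have h2 := mul_le_mul_of_nonneg_right hl (Nat.cast_nonneg (α := ℝ) #S)
        linarith

theorem mem_visitedEdges_iff {V : Type*} [DecidableEq V] (w : Fin (t + 1) → V) (e : Sym2 V) :
    e ∈ visitedEdges w ↔ stepCount {e} w ≠ 0 := by
  simp only [visitedEdges, stepCount, Set.mem_ofPred_eq, mem_singleton, ne_eq, card_eq_zero,
    filter_eq_empty_iff, mem_univ, true_implies, not_forall, not_not, eq_comm (a := e)]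

/-- Distinct visited edges need distinct steps, so counting steps, which suits the Markov recursion,
overestimates collisions. -/
theorem card_visited_le_stepCount {V : Type*} [DecidableEq V] (w : Fin (t + 1) → V)
    {F S : Finset (Sym2 V)} (hF : ∀ e ∈ F, e ∈ visitedEdges w ∧ e ∈ S) : #F ≤ stepCount S w := by
  refine (card_le_card (t := image (fun i : Fin t => s(w i.castSucc, w i.succ))
    {i : Fin t | s(w i.castSucc, w i.succ) ∈ S}) fun e he => ?_).trans card_image_le
  obtain ⟨⟨i, rfl⟩, hS⟩ := hF e he
  exact mem_image.2 ⟨i, by simpa using hS, rfl⟩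

/-- Recovery for all regularized walks adapted from vertex sequences that visit every edge often
and have few collisions in small edge sets. -/
theorem l1Recovers_measurementMatrix {w : Fin m → Fin (t + 1) → Fin n} {d : ℝ} (hd : 0 < d)
    {s : ℕ} (hs : 1 ≤ s)
    (hdeg : ∀ e ∈ G.edgeFinset, d ≤ #{i | stepCount {e} (w i) ≠ 0})
    (hcoll : ∀ S ⊆ G.edgeFinset, S.Nonempty → #S ≤ 2 * s →
      ∑ i, ((stepCount S (w i) - 1 : ℕ) : ℝ) ≤ d / 16 * #S)
    (R : ∀ i, RegularizedWalk G (w i)) {x : G.edgeSet → ℝ} (hx : IsSparse x s) :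
    L1Recovers (measurementMatrix R) x := by
  classical
  have hx' : (Function.support x).ncard ≤ s := Nat.cast_le.1 (show _ ≤ (s : ℝ) from hx)
  refine l1Recovers_of_expansion (measurementMatrix R)
    (fun i => {e | (e : Sym2 (Fin n)) ∈ visitedEdges (w i)}) ?_ ?_ d hd s hs ?_ ?_ x hx'
  · intro i e he
    simp only [mem_filter, mem_univ, true_and] at he
    simp only [measurementMatrix, Matrix.of_apply, Nat.cast_eq_zero, List.count_eq_zero]
    rwa [(R i).mem_edges_iff]
  · intro i e he
    simp only [mem_filter, mem_univ, true_and] at he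
    simp only [measurementMatrix, Matrix.of_apply]
    rw [← (R i).mem_edges_iff, ← List.one_le_count_iff] at he
    exact ⟨by exact_mod_cast he, by exact_mod_cast (R i).count_le_two e⟩
  · intro e
    have := hdeg e (SimpleGraph.mem_edgeFinset.2 e.2)
    simpa [mem_visitedEdges_iff] using this
  · intro S hS
    rcases S.eq_empty_or_nonempty with rfl | hne
    · simp
    set S' : Finset (Sym2 (Fin n)) := S.map (Function.Embedding.subtype _) with hS'
    have hcard : #S' = #S := card_map _
    have h1 := hcoll S' (fun e he => by
      obtain ⟨a, -, rfl⟩ := mem_map.1 he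
      exact SimpleGraph.mem_edgeFinset.2 a.2) (map_nonempty.2 hne) (by omega)
    rw [hcard] at h1
    refine le_trans (sum_le_sum fun i _ => ?_) h1
    have h2 : #((univ.filter fun e : G.edgeSet => (e : Sym2 (Fin n)) ∈ visitedEdges (w i)) ∩ S)
        ≤ stepCount S' (w i) := by
      rw [← card_map (Function.Embedding.subtype _)]
      refine card_visited_le_stepCount (w i) fun e he => ?_
      obtain ⟨a, ha, rfl⟩ := mem_map.1 he
      simp only [mem_inter, mem_filter, mem_univ, true_and] at ha
      exact ⟨ha.1, mem_map_of_mem _ ha.2⟩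
    exact_mod_cast Nat.sub_le_sub_right h2 1

/-- The sum is `(1 + x) ^ #F - 1 ≤ exp (#F * x) - 1`. -/
theorem sum_nonempty_powerset_pow_le {α : Type*} [DecidableEq α] (F : Finset α) {x : ℝ}
    (hx : 0 ≤ x) (hFx : #F * x ≤ 1) :
    ∑ S ∈ F.powerset with S.Nonempty, x ^ #S ≤ 2 * (#F * x) := by
  have h1 : ∑ S ∈ F.powerset, x ^ #S = (1 + x) ^ #F := by
    rw [← prod_const, prod_one_add]
    simp
  have h2 : ({S ∈ F.powerset | S.Nonempty} : Finset (Finset α)) = F.powerset.erase ∅ := by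
    ext S
    simp [nonempty_iff_ne_empty, and_comm]
  have h3 := add_sum_erase F.powerset (fun S => x ^ #S) (empty_mem_powerset F)
  simp only [card_empty, pow_zero] at h3
  have h4 : (1 + x) ^ #F ≤ Real.exp (#F * x) := by
    rw [Real.exp_nat_mul]
    gcongr
    linarith [Real.add_one_le_exp x]
  have h5 := (abs_le.1 (Real.abs_exp_sub_one_le (x := #F * x)
    (by rwa [abs_of_nonneg (by positivity)]))).2
  rw [abs_of_nonneg (by positivity)] at h5
  rw [h2]
  linarith

theorem one_sub_le_measureReal_recovers (hW : ∀ i, IsGoodStartWalk G P (W i))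
    (hind : iIndepFun W P) (hG : ∀ v, 0 < G.degree v) (hE : 0 < numEdges G) {s : ℕ} (hs : 1 ≤ s)
    (hn : 2 ≤ n)
    (h : ∀ S ⊆ G.edgeFinset, #S ≤ 2 * s → ∀ t' ≤ t, ∀ u, expCount G S t' u ≤ 1 / 2000) {r : ℝ}
    (hr1 : r / 2 ≤ t / numEdges G) (hr2 : t / numEdges G ≤ r)
    (hl : 4000 * Real.log n ≤ m * r) :
    1 - 3 / (n : ℝ) ≤ P.real {ω | ∀ R : ∀ i, RegularizedWalk G (W i ω),
        ∀ x : G.edgeSet → ℝ, IsSparse x s → L1Recovers (measurementMatrix R) x} := by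
  set good := {ω | ∀ R : ∀ i, RegularizedWalk G (W i ω),
        ∀ x : G.edgeSet → ℝ, IsSparse x s → L1Recovers (measurementMatrix R) x}
  have hn' : (2 : ℝ) ≤ n := by exact_mod_cast hn
  have hlog : 0 < Real.log n := Real.log_pos (by linarith)
  have hr0 : 0 ≤ r := (by positivity : (0 : ℝ) ≤ t / numEdges G).trans hr2
  set x := Real.exp (-(4 * Real.log n)) with hx
  have hxn : x = 1 / (n : ℝ) ^ 4 := by
    rw [hx, Real.exp_neg, show (4 : ℝ) = ((4 : ℕ) : ℝ) by norm_num, Real.exp_nat_mul,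
      Real.exp_log (by linarith), one_div]
  set bad₁ := fun e : Sym2 (Fin n) =>
    {ω | (#{i | stepCount {e} (W i ω) ≠ 0} : ℝ) < m * r / 16}
  set bad₂ := fun S : Finset (Sym2 (Fin n)) =>
    {ω | m * r / 16 / 16 * #S < ∑ i, ((stepCount S (W i ω) - 1 : ℕ) : ℝ)}
  set 𝒮 := {S ∈ G.edgeFinset.powerset | S.Nonempty}
  set 𝒮' := {S ∈ 𝒮 | #S ≤ 2 * s}
  -- Covering the whole space bounds `good` from below by subadditivity alone, without its
  -- measurability.
  have hcover : Set.univ ⊆ good ∪ ((⋃ e ∈ G.edgeFinset, bad₁ e) ∪ ⋃ S ∈ 𝒮', bad₂ S) := by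
    intro ω _
    by_contra hω
    simp only [Set.mem_union, not_or, Set.mem_iUnion, not_exists] at hω
    obtain ⟨hω, hω1, hω2⟩ := hω
    refine hω fun R y hy => l1Recovers_measurementMatrix (d := m * r / 16) (by linarith) hs
      (fun e he => not_lt.1 (hω1 e he)) (fun S hS hne hc => not_lt.1 (hω2 S ?_)) R hy
    exact mem_filter.2 ⟨mem_filter.2 ⟨mem_powerset.2 hS, hne⟩, hc⟩
  have hEn : (numEdges G : ℝ) ≤ n ^ 2 := by
    have h1 : 2 * numEdges G ≤ n * n := by
      rw [numEdges, ← G.sum_degrees_eq_twice_card_edges]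
      refine (sum_le_card_nsmul univ _ n fun v _ => ?_).trans (by simp)
      simpa using (G.degree_lt_card_verts v).le
    have h2 : (2 * numEdges G : ℝ) ≤ n * n := by exact_mod_cast h1
    nlinarith
  have hEx : numEdges G * x ≤ 1 / n ^ 2 := by
    calc numEdges G * x ≤ (n : ℝ) ^ 2 * x := by gcongr
      _ = 1 / n ^ 2 := by rw [hxn]; field_simp
  have hb1 : P.real (⋃ e ∈ G.edgeFinset, bad₁ e) ≤ numEdges G * x := by
    refine (measureReal_biUnion_finset_le _ _).trans ?_
    rw [numEdges, ← nsmul_eq_mul]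
    refine sum_le_card_nsmul _ _ _ fun e he => ?_
    exact measureReal_few_visits_le hW hind hG hE he
      (h {e} (singleton_subset_iff.2 he) (by rw [card_singleton]; omega)) hr1 hr0 hl
  have hsq : 1 / (n : ℝ) ^ 2 ≤ 1 / n :=
    one_div_le_one_div_of_le (by linarith) (by nlinarith)
  have hn1 : 1 / (n : ℝ) ≤ 1 := by
    rw [div_le_one (by linarith)]; linarith
  have hb2 : P.real (⋃ S ∈ 𝒮', bad₂ S) ≤ 2 * (numEdges G * x) := by
    refine (measureReal_biUnion_finset_le _ _).trans ?_
    calc ∑ S ∈ 𝒮', P.real (bad₂ S) ≤ ∑ S ∈ 𝒮', x ^ #S := by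
          refine sum_le_sum fun S hS => ?_
          have h1 := mem_filter.1 hS
          have h2 := mem_powerset.1 (mem_filter.1 h1.1).1
          exact measureReal_many_collisions_le hW hind hG hE h2 (h S h2 h1.2) hr2 hr0 hl
      _ ≤ ∑ S ∈ 𝒮, x ^ #S := sum_le_sum_of_subset_of_nonneg (filter_subset _ _)
          fun S _ _ => by positivity
      _ ≤ 2 * (numEdges G * x) := sum_nonempty_powerset_pow_le _ (Real.exp_pos _).le
          (hEx.trans (hsq.trans hn1))
  have h1 : 1 ≤ P.real good + (P.real (⋃ e ∈ G.edgeFinset, bad₁ e) + P.real (⋃ S ∈ 𝒮', bad₂ S)) :=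
    calc (1 : ℝ) = P.real Set.univ := probReal_univ.symm
      _ ≤ _ := measureReal_mono hcover
      _ ≤ _ := (measureReal_union_le _ _).trans (by gcongr; exact measureReal_union_le _ _)
  have h3 : 3 / (n : ℝ) = 3 * (1 / n) := by ring
  linarith

end GraphCS

/-! ### Choice of parameters and the main theorem -/

namespace GraphCS

/-- At time 0, two starting vertices give one vertex masses 1 and 0, which cannot both be within
less than `1 / 2` of its stationary mass. -/
theorem IsMixingTime.pos {n : ℕ} {G : SimpleGraph (Fin n)} [DecidableRel G.Adj] {δ : ℝ} {T : ℕ}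
    (hn : 2 ≤ n) (hδ : δ < 1 / 2) (hT : IsMixingTime G δ T) : 0 < T := by
  by_contra h0
  have hT0 : T = 0 := by omega
  subst hT0
  have h1 := hT.1 ⟨0, by omega⟩ ⟨0, by omega⟩
  have h2 := hT.1 ⟨1, by omega⟩ ⟨0, by omega⟩
  rw [pow_zero, Matrix.one_apply_eq] at h1
  rw [pow_zero, Matrix.one_apply_ne (by simp)] at h2
  have h3 := (abs_le.1 h1).2
  have h4 := (abs_le.1 h2).1
  linarith

theorem two_mul_numEdges_bounds {n : ℕ} {G : SimpleGraph (Fin n)} [DecidableRel G.Adj] {D : ℕ}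
    {c : ℝ} (hG : IsUniform G D c) :
    (n : ℝ) * D ≤ 2 * numEdges G ∧ (2 * numEdges G : ℝ) ≤ n * (c * D) := by
  have h : (2 * numEdges G : ℝ) = ∑ v, (G.degree v : ℝ) := by
    exact_mod_cast G.sum_degrees_eq_twice_card_edges.symm
  rw [h]
  constructor
  · have := Finset.card_nsmul_le_sum Finset.univ (fun v => (G.degree v : ℝ)) D
      fun v _ => by exact_mod_cast (hG v).1
    simpa using this
  · have := Finset.sum_le_card_nsmul Finset.univ (fun v => (G.degree v : ℝ)) (c * D)
      fun v _ => (hG v).2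
    simpa using this

end GraphCS

theorem mainTheorem1 :
    ∀ B : ℝ, 0 < B →
    ∃ τ C C₀ : ℝ, 0 < τ ∧ 0 < C ∧ 0 < C₀ ∧
    ∀ (c : ℝ) (T₀ : ℕ), 1 ≤ c →
    ∀ ε : ℝ, 0 < ε →
    ∃ N : ℕ, ∀ n : ℕ, N ≤ n →
    ∀ (G : SimpleGraph (Fin n)) [DecidableRel G.Adj] (D k T : ℕ),
      GraphCS.IsUniform G D c →
      GraphCS.IsMixingTime G (1 / (2 * c * n) ^ 2) T →
      T ≤ T₀ →
      1 ≤ k →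
      C₀ * c ^ 2 * k * T ^ 2 ≤ D →
    ∀ (m t : ℕ),
      m = ⌈C * T * k * Real.log n⌉₊ →
      t = ⌊τ * GraphCS.numEdges G / k⌋₊ →
    ∀ (Ω : Type*) [MeasurableSpace Ω] (P : MeasureTheory.Measure Ω)
      [MeasureTheory.IsProbabilityMeasure P] (W : Fin m → Ω → Fin (t + 1) → Fin n),
      (∀ i, GraphCS.IsGoodStartWalk G P (W i)) →
      ProbabilityTheory.iIndepFun W P →
      1 - ε ≤ P.real {ω | ∀ R : ∀ i, GraphCS.RegularizedWalk G (W i ω),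
        ∀ x : G.edgeSet → ℝ, GraphCS.IsSparse x (B * k) →
          GraphCS.L1Recovers (GraphCS.measurementMatrix R) x} := by
  intro B₀ _
  -- Enlarging `B` to at least 1 ensures that the sparsity `⌊B * k⌋₊` is at least 1.
  obtain ⟨B, hB, hB1⟩ : ∃ B : ℝ, B₀ ≤ B ∧ 1 ≤ B := ⟨max B₀ 1, le_max_left _ _, le_max_right _ _⟩
  have hB0 : 0 < B := by linarith
  -- With `r = τ / k`, `τ` and `C₀` make the stationary and the pre-mixing parts of `expCount` at
  -- most `1 / 4000` each for `2 * B * k` edges; `C` is `4000 / τ`, so that `m * r ≥ 4000 * log n`.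
  refine ⟨1 / (16000 * B), 64000000 * B, 8000 * B, by positivity, by positivity, by positivity, ?_⟩
  intro c T₀ hc ε hε
  refine ⟨max 4 ⌈3 / ε⌉₊, ?_⟩
  intro n hn G _ D k T hG hT _ hk hD m t hm ht Ω _ P _ W hW hind
  have hn4 : 4 ≤ n := (le_max_left _ _).trans hn
  have hn4' : (4 : ℝ) ≤ n := by exact_mod_cast hn4
  have hk' : (1 : ℝ) ≤ k := by exact_mod_cast hk
  have hlog : 0 < Real.log n := Real.log_pos (by linarith)
  have hcn : 4 ≤ c * n := by nlinarith
  have hδ : 1 / (2 * c * n) ^ 2 < (1 / 2 : ℝ) :=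
    one_div_lt_one_div_of_lt two_pos (by nlinarith)
  have hT1 : (1 : ℝ) ≤ T := by exact_mod_cast hT.pos (by omega) hδ
  have hDT : 8000 * B * k * T ≤ D := by
    refine le_trans ?_ hD
    have h1 : (1 : ℝ) ≤ c ^ 2 := one_le_pow₀ hc
    have h2 : (T : ℝ) ≤ T ^ 2 := le_self_pow₀ hT1 two_ne_zero
    calc 8000 * B * k * T = 8000 * B * 1 * k * T := by ring
      _ ≤ 8000 * B * c ^ 2 * k * T ^ 2 := by gcongr
  have hDk : 8000 * B * k ≤ D := le_trans (le_mul_of_one_le_right (by positivity) hT1) hDT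
  have hD0' : (0 : ℝ) < D := lt_of_lt_of_le (by positivity) hDk
  have hD0 : 0 < D := by exact_mod_cast hD0'
  obtain ⟨hE1, hE2⟩ := GraphCS.two_mul_numEdges_bounds hG
  set M := GraphCS.numEdges G
  have hM0' : (0 : ℝ) < M := by
    have : (0 : ℝ) < n * D := by positivity
    linarith
  have hM0 : 0 < M := by exact_mod_cast hM0'
  have hdeg : ∀ v, D ≤ G.degree v := fun v => (hG v).1
  have hk0 : (0 : ℝ) < k := by linarith
  set r : ℝ := 1 / (16000 * B) / k with hr
  have hr0 : 0 < r := by positivity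
  have hrM : 1 / (16000 * B) * (M : ℝ) / k = r * M := by rw [hr]; ring
  rw [hrM] at ht
  -- Since `r * M ≥ 1`, the floor defining `t` loses at most a factor 2.
  have hrM1 : 1 ≤ r * M := by
    have h1 : 4 * (8000 * B * k) ≤ n * D := by gcongr
    rw [hr, div_div, div_mul_eq_mul_div, one_mul, le_div_iff₀ (by positivity)]
    linarith
  have ht1 : (t : ℝ) ≤ r * M := ht ▸ Nat.floor_le (by positivity)
  have ht2 : r * M / 2 ≤ t := by
    have h1 : r * M < t + 1 := ht ▸ Nat.lt_floor_add_one _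
    have h2 : (1 : ℝ) ≤ t := by exact_mod_cast ht ▸ Nat.le_floor (by exact_mod_cast hrM1)
    linarith
  have htr : (t : ℝ) / M ≤ r := (div_le_iff₀ hM0').2 ht1
  have htr' : r / 2 ≤ (t : ℝ) / M := by
    rw [le_div_iff₀ hM0']; linarith
  have hBk : 1 ≤ B * k := by nlinarith
  set s := ⌊B * k⌋₊
  have hs : 1 ≤ s := Nat.le_floor (by exact_mod_cast hBk)
  have hsB : (s : ℝ) ≤ B * k := Nat.floor_le (by positivity)
  -- Here `2 * M ≤ c * n * D`, and the mixing accuracy absorbs the factor `c * n`.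
  have hδE : 2 * (1 / (2 * c * n) ^ 2) * M ≤ (D : ℝ) := by
    have h1 : (0 : ℝ) < (2 * c * n) ^ 2 := by nlinarith
    rw [mul_one_div, div_mul_eq_mul_div, div_le_iff₀ h1]
    have h2 : (n : ℝ) * (c * D) = D * (c * n) := by ring
    have h3 : c * n ≤ (2 * c * n) ^ 2 := by nlinarith
    have h4 := mul_le_mul_of_nonneg_left h3 hD0'.le
    linarith
  have hl : 4000 * Real.log n ≤ m * r := by
    have h1 : 64000000 * B * T * k * Real.log n ≤ m := hm ▸ Nat.le_ceil _
    have h2 := mul_le_mul_of_nonneg_right h1 hr0.le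
    have h3 : 64000000 * B * T * k * Real.log n * r = 4000 * (T * Real.log n) := by
      rw [hr]; field_simp; norm_num
    have h4 := le_mul_of_one_le_left hlog.le hT1
    linarith
  have hexp : ∀ S ⊆ G.edgeFinset, S.card ≤ 2 * s → ∀ t' ≤ t, ∀ u,
      GraphCS.expCount G S t' u ≤ 1 / 2000 := by
    intro S hS hcard t' ht' u
    refine (GraphCS.expCount_le hD0 hdeg hT.1 hM0 hδE hS ht' u).trans ?_
    have hc' : (S.card : ℝ) ≤ 2 * (B * k) := by
      have : (S.card : ℝ) ≤ 2 * s := by exact_mod_cast hcard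
      linarith
    have h1 : (T : ℝ) * (S.card / D) ≤ 1 / 4000 := by
      rw [mul_div_assoc', div_le_iff₀ hD0']
      have := mul_le_mul_of_nonneg_left hc' (Nat.cast_nonneg (α := ℝ) T)
      linarith
    have h2 : (t : ℝ) * (2 * (S.card / M)) ≤ 1 / 4000 := by
      calc (t : ℝ) * (2 * (S.card / M)) = 2 * S.card * (t / M) := by ring
        _ ≤ 2 * (2 * (B * k)) * r := by gcongr
        _ = 1 / 4000 := by rw [hr]; field_simp; norm_num
    linarith
  have hmain := GraphCS.one_sub_le_measureReal_recovers hW hind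
    (fun v => hD0.trans_le (hdeg v)) hM0 hs (by omega) hexp htr' htr hl
  have hεn : 3 / (n : ℝ) ≤ ε := by
    have h1 : 3 / ε ≤ n :=
      (Nat.le_ceil _).trans (by exact_mod_cast (le_max_right _ _).trans hn)
    rw [div_le_iff₀ hε] at h1
    rw [div_le_iff₀ (by linarith)]
    linarith
  refine (by linarith : 1 - ε ≤ 1 - 3 / (n : ℝ)).trans (hmain.trans ?_)
  refine MeasureTheory.measureReal_mono fun ω hω R x hx => hω R x ?_
  have hx' : ((Function.support x).ncard : ℝ) ≤ B * k :=
    le_trans hx (mul_le_mul_of_nonneg_right hB hk0.le)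
  exact Nat.cast_le.2 (Nat.le_floor hx')
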